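/- Let $(\mathcal H,[\cdot,\cdot])$ be a (complex) Krein space, i.e. a complex vector space with a hermitian sesquilinear form that admits a fundamental decomposition: a direct, $[\cdot,\cdot]$-orthogonal sum $\mathcal H=\mathcal H_+[\dotplus]\mathcal H_-$ in which $(\mathcal H_+,[\cdot,\cdot])$ and $(\mathcal H_-,-[\cdot,\cdot])$ are Hilbert spaces. Endow $\mathcal H$ with the Hilbert space inner product $\langle x_++x_-,y_++y_-\rangle=[x_+,y_+]-[x_-,y_-]$ and the norm $\|\cdot\|$ induced by some fundamental decomposition (all such norms are equivalent). A subspace $\mathcal S$ is uniformly $J$-positive (resp. $J$-negative) if for some $\alpha>0$ one has $[x,x]\ge\alpha\|x\|^2$ (resp. $-[x,x]\ge\alpha\|x\|^2$) for all $x\in\mathcal S$. For a Bessel family $\mathcal F=\{f_i\}_{i\in I}$ in $\mathcal H$ let $T:\ell_2(I)\to\mathcal H$, $Tx=\sum_{i\in I}x_if_i$, be its synthesis operator, $I_+=\{i:[f_i,f_i]\ge0\}$, $I_-=\{i:[f_i,f_i]<0\}$. $\mathcal F$ is a $J$-frame if $T(\ell_2(I_+))$ is a maximal uniformly $J$-positive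 subspace and $T(\ell_2(I_-))$ is a maximal uniformly $J$-negative subspace of $\mathcal H$. A $J$-frame is a Parseval $J$-frame if $TT^+=\mathrm{Id}$, where $T^+:\mathcal H\to\ell_2(I)$ is the bounded operator with $[Tx,y]=[x,T^+y]_2$ for all $x\in\ell_2(I)$, $y\in\mathcal H$, and $[x,y]_2=\sum_{i\in I_+}x_i\overline{y_i}-\sum_{i\in I_-}x_i\overline{y_i}$. Families $\{f_i\}_{i\in I}$ and $\{q_i\}_{i\in I}$ are similar if there is a bounded invertible operator $V$ on $\mathcal H$ with bounded inverse such that $Vf_i=q_i$ for all $i\in I$. **Proposition.** Let $\mathcal F=\{f_i\}_{i\in I}$ be a $J$-frame for a Krein space $\mathcal H$ and let $\mathcal H=\mathcal H_+[\dotplus]\mathcal H_-$ be any fixed fundamental decomposition. Then there exists a Parseval $J$-frame $\mathcal Q=\{q_i\}_{i\in I}$ for $\mathcal H$ which is similar to $\mathcal F$ and satisfies $$\mathcal H_+=\overline{\operatorname{span}\{q_i:\ i\in I,\ [q_i,q_i]>0\}}.$$ -/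

import Mathlib

open Filter Topology

noncomputable section

namespace Krein

section Forms

variable {H : Type*} [AddCommGroup H] [Module ℂ H]

/-- `B` restricted to `M` is a Hilbert space inner product: it is positive definite on `M` and `M`
is complete for the norm `x ↦ (B x x) ^ (1 / 2)` (the conditions are written for squared norms). -/
structure IsHilbertOn (B : H →ₗ⋆[ℂ] H →ₗ[ℂ] ℂ) (M : Submodule ℂ H) : Prop where
  pos : ∀ x ∈ M, x ≠ 0 → 0 < (B x x).re
  complete : ∀ u : ℕ → H, (∀ n, u n ∈ M) →
    (∀ ε : ℝ, 0 < ε → ∃ N, ∀ m, N ≤ m → ∀ n, N ≤ n → (B (u m - u n) (u m - u n)).re < ε) →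
    ∃ x ∈ M, Tendsto (fun n => (B (u n - x) (u n - x)).re) atTop (𝓝 0)

/-- `H = Hp [∔] Hm` is a fundamental decomposition for `B`: a direct, `B`-orthogonal sum of the
Hilbert spaces `(Hp, B)` and `(Hm, -B)`. -/
structure IsFundamentalDecomposition (B : H →ₗ⋆[ℂ] H →ₗ[ℂ] ℂ) (Hp Hm : Submodule ℂ H) :
    Prop where
  isCompl : IsCompl Hp Hm
  orthogonal : ∀ x ∈ Hp, ∀ y ∈ Hm, B x y = 0
  hilbert_pos : IsHilbertOn B Hp
  hilbert_neg : IsHilbertOn (-B) Hm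

/-- `Tp` is the adjoint of `T` with respect to the (indefinite) inner products `BK` and `BH`. -/
def IsKreinAdjoint {K : Type*} (BK : K → K → ℂ) (BH : H → H → ℂ) (T : K → H) (Tp : H → K) :
    Prop :=
  ∀ x y, BH (T x) y = BK x (Tp y)

end Forms

section KreinSpace

variable {H : Type*} [NormedAddCommGroup H] [InnerProductSpace ℂ H]

/-- `H`, with the indefinite inner product `B` (`B y x` is `[x, y]`, which is linear in `x`), is a
Krein space, and the inner product carried by `H` is the one induced by some fundamental
decomposition. -/
structure IsKreinSpace (B : H →ₗ⋆[ℂ] H →ₗ[ℂ] ℂ) : Prop where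
  hermitian : ∀ x y, starRingEnd ℂ (B x y) = B y x
  exists_decomposition : ∃ Hp Hm : Submodule ℂ H, IsFundamentalDecomposition B Hp Hm ∧
    ∀ xp ∈ Hp, ∀ xm ∈ Hm, ∀ yp ∈ Hp, ∀ ym ∈ Hm,
      inner ℂ (xp + xm) (yp + ym) = B xp yp - B xm ym

/-- Uniformly `J`-positive subspaces. -/
def IsUniformlyPositive (B : H →ₗ⋆[ℂ] H →ₗ[ℂ] ℂ) (M : Submodule ℂ H) : Prop :=
  ∃ α : ℝ, 0 < α ∧ ∀ x ∈ M, α * ‖x‖ ^ 2 ≤ (B x x).re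

/-- Uniformly `J`-negative subspaces. -/
def IsUniformlyNegative (B : H →ₗ⋆[ℂ] H →ₗ[ℂ] ℂ) (M : Submodule ℂ H) : Prop :=
  ∃ α : ℝ, 0 < α ∧ ∀ x ∈ M, α * ‖x‖ ^ 2 ≤ -(B x x).re

end KreinSpace

section Frames

variable {H : Type*} [NormedAddCommGroup H] [InnerProductSpace ℂ H] {I : Type*}

/-- Bessel families. -/
def IsBessel (f : I → H) : Prop :=
  ∃ β : ℝ, 0 < β ∧ ∀ x : H, Summable (fun i => ‖inner ℂ (f i) x‖ ^ 2) ∧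
    ∑' i, ‖inner ℂ (f i) x‖ ^ 2 ≤ β * ‖x‖ ^ 2

/-- The Hilbert space `ℓ₂(I)`. -/
abbrev L2 (I : Type*) : Type _ := lp (fun _ : I => ℂ) 2

theorem IsBessel.exists_bound {f : I → H} (hf : IsBessel f) :
    ∃ C : ℝ, 0 ≤ C ∧ ∀ (s : Finset I) (c : I → ℂ),
      ‖∑ i ∈ s, c i • f i‖ ^ 2 ≤ C * ∑ i ∈ s, ‖c i‖ ^ 2 := by
  obtain ⟨β, hβ, h⟩ := hf
  refine ⟨β, hβ.le, fun s c => ?_⟩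
  set y := ∑ i ∈ s, c i • f i with hy
  have h1 : ‖y‖ ^ 2 ≤ ∑ i ∈ s, ‖c i‖ * ‖inner ℂ (f i) y‖ := by
    have e : inner ℂ y y = ∑ i ∈ s, starRingEnd ℂ (c i) * inner ℂ (f i) y := by
      conv_lhs => rw [hy, sum_inner]
      exact Finset.sum_congr rfl fun i _ => by rw [inner_smul_left, ← hy]
    have e2 : ‖y‖ ^ 2 = ‖(inner ℂ y y : ℂ)‖ := by
      rw [inner_self_eq_norm_sq_to_K]; simp
    rw [e2, e]
    refine (norm_sum_le _ _).trans (Finset.sum_le_sum fun i _ => ?_)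
    simp
  have h2 := Finset.sum_mul_sq_le_sq_mul_sq s (fun i => ‖c i‖) (fun i => ‖inner ℂ (f i) y‖)
  have h3 : ∑ i ∈ s, ‖inner ℂ (f i) y‖ ^ 2 ≤ β * ‖y‖ ^ 2 :=
    ((h y).1.sum_le_tsum s fun i _ => by positivity).trans (h y).2
  have h4 : 0 ≤ ∑ i ∈ s, ‖c i‖ ^ 2 := Finset.sum_nonneg fun i _ => by positivity
  have h5 : (‖y‖ ^ 2) ^ 2 ≤ (∑ i ∈ s, ‖c i‖ ^ 2) * (β * ‖y‖ ^ 2) :=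
    (pow_le_pow_left₀ (by positivity) h1 2).trans
      (h2.trans (mul_le_mul_of_nonneg_left h3 h4))
  rcases eq_or_lt_of_le (sq_nonneg ‖y‖) with h0 | h0
  · rw [← h0]; positivity
  · nlinarith

theorem L2.hasSum_norm_sq (x : L2 I) : HasSum (fun i => ‖x i‖ ^ 2) (‖x‖ ^ 2) := by
  have := lp.hasSum_norm (p := 2) (by norm_num) x
  simpa using this

theorem IsBessel.summable [CompleteSpace H] {f : I → H} (hf : IsBessel f) (x : L2 I) :
    Summable (fun i => x i • f i) := by
  obtain ⟨C, hC, h⟩ := hf.exists_bound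
  rw [summable_iff_vanishing_norm]
  intro ε hε
  have hs := summable_iff_vanishing_norm.1 (L2.hasSum_norm_sq x).summable
    (ε ^ 2 / (C + 1)) (by positivity)
  obtain ⟨s, hs⟩ := hs
  refine ⟨s, fun t ht => ?_⟩
  have h1 := hs t ht
  rw [Real.norm_of_nonneg (Finset.sum_nonneg fun i _ => by positivity),
    lt_div_iff₀ (by positivity)] at h1
  have h2 := h t x
  have h3 : 0 ≤ ∑ i ∈ t, ‖x i‖ ^ 2 := Finset.sum_nonneg fun i _ => by positivity
  exact lt_of_pow_lt_pow_left₀ 2 hε.le (by nlinarith)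

/-- The synthesis operator `T : ℓ₂(I) → H`, `T x = ∑ xᵢ fᵢ`, of a Bessel family. -/
def synthesis [CompleteSpace H] (f : I → H) (hf : IsBessel f) : L2 I →L[ℂ] H :=
  LinearMap.mkContinuousOfExistsBound
    { toFun := fun x => ∑' i, x i • f i
      map_add' := fun x y => by
        rw [← (hf.summable x).tsum_add (hf.summable y)]
        exact tsum_congr fun i => by rw [← add_smul]; rfl
      map_smul' := fun c x => by
        rw [RingHom.id_apply, ← (hf.summable x).tsum_const_smul c]
        exact tsum_congr fun i => by rw [← smul_assoc]; rfl }
    (by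
      obtain ⟨C, hC, h⟩ := hf.exists_bound
      refine ⟨Real.sqrt C, fun x => ?_⟩
      refine le_of_tendsto (hf.summable x).hasSum.norm (Eventually.of_forall fun s => ?_)
      refine le_of_sq_le_sq ?_ (by positivity)
      rw [mul_pow, Real.sq_sqrt hC]
      exact (h s x).trans (mul_le_mul_of_nonneg_left
        (sum_le_hasSum s (fun i _ => by positivity) (L2.hasSum_norm_sq x)) hC))

/-- The subspace `ℓ₂(A)` of `ℓ₂(I)`, for `A ⊆ I`. -/
def L2.supportedOn (A : Set I) : Submodule ℂ (L2 I) where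
  carrier := {x | ∀ i, i ∉ A → x i = 0}
  add_mem' := fun {x y} hx hy i hi => by
    change x i + y i = 0
    rw [hx i hi, hy i hi, add_zero]
  zero_mem' := fun _ _ => rfl
  smul_mem' := fun c x hx i hi => by
    change c • x i = 0
    rw [hx i hi, smul_zero]

/-- `I₊ = {i | [fᵢ, fᵢ] ≥ 0}`. -/
def indexPos (B : H →ₗ⋆[ℂ] H →ₗ[ℂ] ℂ) (f : I → H) : Set I := {i | 0 ≤ (B (f i) (f i)).re}

/-- `I₋ = {i | [fᵢ, fᵢ] < 0}`. -/
def indexNeg (B : H →ₗ⋆[ℂ] H →ₗ[ℂ] ℂ) (f : I → H) : Set I := {i | (B (f i) (f i)).re < 0}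

/-- `f` is a `J`-frame: it is a Bessel family, `R(T₊) = T(ℓ₂(I₊))` is a maximal uniformly
`J`-positive subspace and `R(T₋) = T(ℓ₂(I₋))` is a maximal uniformly `J`-negative subspace. -/
def IsJFrame [CompleteSpace H] (B : H →ₗ⋆[ℂ] H →ₗ[ℂ] ℂ) (f : I → H) : Prop :=
  ∃ hf : IsBessel f,
    Maximal (IsUniformlyPositive B)
      ((L2.supportedOn (indexPos B f)).map (synthesis f hf : L2 I →ₗ[ℂ] H)) ∧
    Maximal (IsUniformlyNegative B)
      ((L2.supportedOn (indexNeg B f)).map (synthesis f hf : L2 I →ₗ[ℂ] H))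

/-- The indefinite inner product that the partition `I = I₊ ∪ I₋` induces on `ℓ₂(I)`. -/
def L2.indefinite (B : H →ₗ⋆[ℂ] H →ₗ[ℂ] ℂ) (f : I → H) (x y : L2 I) : ℂ :=
  (∑' i : indexPos B f, starRingEnd ℂ (x i) * y i) -
    (∑' i : indexNeg B f, starRingEnd ℂ (x i) * y i)

/-- `f` is a Parseval `J`-frame: it is a `J`-frame and its `J`-frame operator `T T⁺` is the
identity, where `T⁺` is the adjoint of the synthesis operator `T` in the sense of Krein spaces. -/
def IsParsevalJFrame [CompleteSpace H] (B : H →ₗ⋆[ℂ] H →ₗ[ℂ] ℂ) (f : I → H) : Prop :=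
  IsJFrame B f ∧ ∃ (hf : IsBessel f) (Tp : H →L[ℂ] L2 I),
    IsKreinAdjoint (L2.indefinite B f) (fun x y => B x y) (synthesis f hf) Tp ∧
    (synthesis f hf) ∘L Tp = ContinuousLinearMap.id ℂ H

/-- Two families are similar if an invertible bounded operator maps one onto the other,
index by index. -/
def IsSimilar (f g : I → H) : Prop :=
  ∃ V : H ≃L[ℂ] H, ∀ i, V (f i) = g i

end Frames

end Krein

end

/-! Let `J` be the fundamental symmetry of the inner product of `H`, and `M±` the ranges
`T(ℓ₂(I±))`. In the Hilbert space setting the Parseval family similar to a frame is the frame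
multiplied by the inverse square root of its frame operator. The same works here once the frame is
straightened to be compatible with `J`.

A maximal uniformly positive subspace is the graph of a strict contraction between the eigenspaces
of `J`, and dually for negative ones. The two contractions for a pair of subspaces add up to an
operator of norm below 1, so a Neumann series yields an invertible operator taking the eigenspaces
of `J` onto the pair (`exists_unit_map`). Let `W` do this for `M±` and `U` for the given
decomposition, whose parts are themselves maximal uniformly definite.

The vectors `W⁻¹ fᵢ` are eigenvectors of `J`, so their Hilbert space frame operator commutes with
`J`, and so does its inverse square root `S`. Likewise `U* J U J` is positive, invertible and
commutes with `J`. Its inverse square root `C` makes `U C` an isometry of the indefinite form: `(U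
C)* J (U C) = J`. Then `V = U C S W⁻¹` takes `M±` onto the given decomposition, and `qᵢ = V fᵢ` is
the required family. The Parseval identity is algebra (`parseval_identity`), and `qᵢ ≠ 0` in the
positive part forces `[qᵢ, qᵢ] > 0`, which gives the closed span. -/

noncomputable section

namespace Krein

/-! ### Fundamental symmetries and their eigenspaces -/

section Symmetry

variable {H : Type*} [NormedAddCommGroup H] [InnerProductSpace ℂ H]

/-- `J` is the fundamental symmetry that relates the form `B` to the inner product of `H`. -/
structure IsFundamentalSymmetry (B : H →ₗ⋆[ℂ] H →ₗ[ℂ] ℂ) (J : H →L[ℂ] H) : Prop where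
  involutive : ∀ x, J (J x) = x
  symmetric : ∀ x y, inner ℂ (J x) y = inner ℂ x (J y)
  form_eq : ∀ x y, B x y = inner ℂ (J x) y

/-- The subspace of fixed vectors of `J`. -/
def fixed (J : H →L[ℂ] H) : Submodule ℂ H where
  carrier := {x | J x = x}
  add_mem' := fun {x y} hx hy => by
    change J (x + y) = x + y
    rw [map_add, hx, hy]
  zero_mem' := map_zero J
  smul_mem' := fun c x hx => by
    change J (c • x) = c • x
    rw [map_smul, hx]

theorem mem_fixed {J : H →L[ℂ] H} {x : H} : x ∈ fixed J ↔ J x = x := Iff.rfl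

theorem mem_fixed_neg {J : H →L[ℂ] H} {x : H} : x ∈ fixed (-J) ↔ J x = -x := by
  rw [mem_fixed, neg_apply, neg_eq_iff_eq_neg]

theorem IsFundamentalSymmetry.neg {B : H →ₗ⋆[ℂ] H →ₗ[ℂ] ℂ} {J : H →L[ℂ] H}
    (h : IsFundamentalSymmetry B J) : IsFundamentalSymmetry (-B) (-J) where
  involutive x := by simp [h.involutive]
  symmetric x y := by simp [h.symmetric]
  form_eq x y := by simp [h.form_eq]

theorem isUniformlyNegative_eq (B : H →ₗ⋆[ℂ] H →ₗ[ℂ] ℂ) :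
    IsUniformlyNegative B = IsUniformlyPositive (-B) := by
  ext M
  simp [IsUniformlyNegative, IsUniformlyPositive]

/-- `J` is the difference of the two projections. It preserves the inner product, which gives its
continuity. -/
theorem IsKreinSpace.exists_isFundamentalSymmetry {B : H →ₗ⋆[ℂ] H →ₗ[ℂ] ℂ}
    (hB : IsKreinSpace B) : ∃ J : H →L[ℂ] H, IsFundamentalSymmetry B J := by
  obtain ⟨Hp, Hm, hD, hin⟩ := hB.exists_decomposition
  set P := Hp.projection Hm hD.isCompl with hP
  set Q := Hm.projection Hp hD.isCompl.symm with hQ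
  have hPm : ∀ x, P x ∈ Hp := fun x => Submodule.projection_apply_mem _ x
  have hQm : ∀ x, Q x ∈ Hm := fun x => Submodule.projection_apply_mem _ x
  have hPQ : ∀ x, P x + Q x = x := fun x =>
    Submodule.projection_add_projection_eq_self hD.isCompl x
  have hPp : ∀ x ∈ Hp, P x = x := fun x hx =>
    (Submodule.projection_eq_self_iff hD.isCompl x).2 hx
  have hQq : ∀ x ∈ Hm, Q x = x := fun x hx =>
    (Submodule.projection_eq_self_iff hD.isCompl.symm x).2 hx
  have hPq : ∀ x ∈ Hm, P x = 0 := fun x hx => by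
    have := hPQ x; rwa [hQq x hx, add_eq_right] at this
  have hQp : ∀ x ∈ Hp, Q x = 0 := fun x hx => by
    have := hPQ x; rwa [hPp x hx, add_eq_left] at this
  have hin' : ∀ x y, inner ℂ x y = B (P x) (P y) - B (Q x) (Q y) := fun x y => by
    conv_lhs => rw [← hPQ x, ← hPQ y]
    exact hin _ (hPm x) _ (hQm x) _ (hPm y) _ (hQm y)
  have hPQ0 : ∀ x y, B (P x) (Q y) = 0 := fun x y => hD.orthogonal _ (hPm x) _ (hQm y)
  have hQP0 : ∀ x y, B (Q x) (P y) = 0 := fun x y => by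
    rw [← hB.hermitian, hPQ0, map_zero]
  have hBx : ∀ x y, B x y = B (P x) (P y) + B (Q x) (Q y) := fun x y => by
    conv_lhs => rw [← hPQ x, ← hPQ y]
    simp [hPQ0, hQP0]
  let J₀ : H →ₗ[ℂ] H := P - Q
  have hPJ : ∀ x, P (J₀ x) = P x := fun x => by
    simp only [J₀, LinearMap.sub_apply, map_sub, hPp _ (hPm x), hPq _ (hQm x), sub_zero]
  have hQJ : ∀ x, Q (J₀ x) = -Q x := fun x => by
    simp only [J₀, LinearMap.sub_apply, map_sub, hQp _ (hPm x), hQq _ (hQm x), zero_sub]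
  have hn : ∀ x, ‖J₀ x‖ ≤ 1 * ‖x‖ := fun x => by
    have : inner ℂ (J₀ x) (J₀ x) = inner ℂ x x := by
      rw [hin', hin' x x, hPJ, hQJ]; simp
    rw [one_mul, @norm_eq_sqrt_re_inner ℂ, @norm_eq_sqrt_re_inner ℂ _ _ _ _ x, this]
  refine ⟨J₀.mkContinuous 1 hn, fun x => ?_, fun x y => ?_, fun x y => ?_⟩
  · change J₀ (J₀ x) = x
    rw [← hPQ (J₀ (J₀ x)), hPJ, hPJ, hQJ, hQJ, neg_neg, hPQ]
  · change inner ℂ (J₀ x) y = inner ℂ x (J₀ y)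
    rw [hin', hin' x, hPJ, hPJ, hQJ, hQJ]; simp
  · change B x y = inner ℂ (J₀ x) y
    rw [hin', hPJ, hQJ, hBx]; simp

variable {B : H →ₗ⋆[ℂ] H →ₗ[ℂ] ℂ} {J : H →L[ℂ] H}

namespace IsFundamentalSymmetry

theorem hermitian (h : IsFundamentalSymmetry B J) (x y : H) :
    starRingEnd ℂ (B x y) = B y x := by
  rw [h.form_eq, h.form_eq, inner_conj_symm, h.symmetric]

theorem continuous_form (h : IsFundamentalSymmetry B J) : Continuous fun x => (B x x).re := by
  simp only [h.form_eq]
  fun_prop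

/-- The projection onto the fixed vectors of a fundamental symmetry. -/
def posProj (J : H →L[ℂ] H) : H →L[ℂ] H := (1 / 2 : ℂ) • (1 + J)

theorem posProj_apply (J : H →L[ℂ] H) (x : H) : posProj J x = (1 / 2 : ℂ) • (x + J x) := rfl

theorem posProj_mem (h : IsFundamentalSymmetry B J) (x : H) : posProj J x ∈ fixed J := by
  rw [mem_fixed, posProj_apply, map_smul, map_add, h.involutive, add_comm]

theorem posProj_eq {x : H} (hx : x ∈ fixed J) : posProj J x = x := by
  rw [posProj_apply, mem_fixed.1 hx, ← two_smul ℂ x, smul_smul]; norm_num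

theorem posProj_eq_zero {x : H} (hx : x ∈ fixed (-J)) : posProj J x = 0 := by
  rw [posProj_apply, mem_fixed_neg.1 hx, add_neg_cancel, smul_zero]

theorem add_posProj (J : H →L[ℂ] H) (x : H) : posProj J x + posProj (-J) x = x := by
  rw [posProj_apply, posProj_apply, ← smul_add, neg_apply,
    add_add_add_comm, add_neg_cancel, add_zero, ← two_smul ℂ x, smul_smul]
  norm_num

theorem inner_eq_zero (h : IsFundamentalSymmetry B J) {x y : H} (hx : x ∈ fixed J)
    (hy : y ∈ fixed (-J)) : inner ℂ x y = 0 := by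
  have h1 := h.symmetric x y
  rw [mem_fixed.1 hx, mem_fixed_neg.1 hy, inner_neg_right] at h1
  exact self_eq_neg.1 h1

theorem norm_add_sq (h : IsFundamentalSymmetry B J) {x y : H} (hx : x ∈ fixed J)
    (hy : y ∈ fixed (-J)) : ‖x + y‖ ^ 2 = ‖x‖ ^ 2 + ‖y‖ ^ 2 := by
  rw [@_root_.norm_add_sq ℂ, h.inner_eq_zero hx hy]; simp

theorem norm_sq_eq (h : IsFundamentalSymmetry B J) (x : H) :
    ‖x‖ ^ 2 = ‖posProj J x‖ ^ 2 + ‖posProj (-J) x‖ ^ 2 := by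
  rw [← h.norm_add_sq (h.posProj_mem x) (h.neg.posProj_mem x), add_posProj]

theorem form_self_eq (h : IsFundamentalSymmetry B J) (x : H) :
    (B x x).re = ‖posProj J x‖ ^ 2 - ‖posProj (-J) x‖ ^ 2 := by
  set a := posProj J x with ha
  set b := posProj (-J) x with hb
  have hab : a + b = x := add_posProj J x
  have h1 : J a = a := mem_fixed.1 (h.posProj_mem x)
  have h2 : J b = -b := mem_fixed_neg.1 (h.neg.posProj_mem x)
  have h3 : inner ℂ a b = 0 := h.inner_eq_zero (h.posProj_mem x) (h.neg.posProj_mem x)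
  have h4 : inner ℂ b a = 0 := inner_eq_zero_symm.1 h3
  rw [h.form_eq, ← hab, map_add, h1, h2]
  simp only [inner_add_left, inner_add_right, inner_neg_left, h3, h4, inner_self_eq_norm_sq_to_K]
  simp [← Complex.ofReal_pow]
  ring

theorem mul_self (h : IsFundamentalSymmetry B J) : J * J = 1 :=
  ContinuousLinearMap.ext h.involutive

end IsFundamentalSymmetry

theorem unit_apply_inv_apply (W : (H →L[ℂ] H)ˣ) (x : H) : W.1 (W⁻¹.1 x) = x := by
  rw [← mul_apply_eq_comp, Units.mul_inv, one_apply_eq_self]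

theorem unit_inv_apply_apply (W : (H →L[ℂ] H)ˣ) (x : H) : W⁻¹.1 (W.1 x) = x := by
  rw [← mul_apply_eq_comp, Units.inv_mul, one_apply_eq_self]

theorem mem_fixed_of_commute {R : H →L[ℂ] H} (hR : Commute R J) {x : H} (hx : x ∈ fixed J) :
    R x ∈ fixed J := by
  rw [mem_fixed, ← mul_apply_eq_comp, ← hR.eq, mul_apply_eq_comp, mem_fixed.1 hx]

theorem indexPos_compl {I : Type*} (B : H →ₗ⋆[ℂ] H →ₗ[ℂ] ℂ) (f : I → H) :
    (indexPos B f)ᶜ = indexNeg B f := by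
  ext i
  simp [indexPos, indexNeg]

end Symmetry

/-! ### Maximal uniformly definite subspaces -/

section Definite

variable {H : Type*} [NormedAddCommGroup H] [InnerProductSpace ℂ H]
  {B : H →ₗ⋆[ℂ] H →ₗ[ℂ] ℂ} {J : H →L[ℂ] H}

open IsFundamentalSymmetry

theorem IsFundamentalDecomposition.neg {Hp Hm : Submodule ℂ H} (h : IsFundamentalSymmetry B J)
    (hD : IsFundamentalDecomposition B Hp Hm) : IsFundamentalDecomposition (-B) Hm Hp where
  isCompl := hD.isCompl.symm
  orthogonal x hx y hy := by
    have : B x y = 0 := by rw [← h.hermitian, hD.orthogonal y hy x hx, map_zero]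
    simp [this]
  hilbert_pos := hD.hilbert_neg
  hilbert_neg := by simpa using hD.hilbert_pos

/-- The norm here may come from another decomposition than `Hp`, `Hm`. Uniform boundedness compares
the two: the unit ball of `(Hp, B)` is weakly bounded in `H`, hence norm bounded. -/
theorem IsFundamentalDecomposition.isUniformlyPositive [CompleteSpace H] {Hp Hm : Submodule ℂ H}
    (h : IsFundamentalSymmetry B J) (hD : IsFundamentalDecomposition B Hp Hm) :
    IsUniformlyPositive B Hp := by
  have hpos : ∀ x ∈ Hp, 0 ≤ (B x x).re := fun x hx => by
    rcases eq_or_ne x 0 with rfl | hx0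
    · simp
    · exact (hD.hilbert_pos.pos x hx hx0).le
  let g : {x : H // x ∈ Hp ∧ (B x x).re ≤ 1} → H →L[ℂ] ℂ := fun x => innerSL ℂ x.1
  obtain ⟨C, hC⟩ : ∃ C, ∀ x, ‖g x‖ ≤ C := by
    refine banach_steinhaus fun y => ?_
    -- Since `⟨x, y⟩ = B x (J y)`, only the `Hp` component `p` of `J y` pairs with `x ∈ Hp`.
    obtain ⟨p, hp, m, hm, hpm⟩ : ∃ p ∈ Hp, ∃ m ∈ Hm, p + m = J y :=
      Submodule.mem_sup.1 (hD.isCompl.sup_eq_top ▸ Submodule.mem_top)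
    refine ⟨(1 + (B p p).re) / 2, fun ⟨x, hx, hx1⟩ => ?_⟩
    have e : inner ℂ x y = B x p := by
      rw [← h.involutive y, ← h.symmetric, ← h.form_eq, ← hpm, map_add,
        hD.orthogonal x hx m hm, add_zero]
    change ‖(inner ℂ x y : ℂ)‖ ≤ _
    rw [e]
    -- Cauchy–Schwarz in additive form: with the phase `u` of the pairing, positivity at `x - u • p`
    -- bounds `2 * ‖B x p‖` by `B x x + B p p`.
    obtain ⟨u, hu, hu'⟩ := RCLike.exists_norm_eq_mul_self (B x p)
    have h1 := hpos (x - u • p) (Hp.sub_mem hx (Hp.smul_mem u hp))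
    have h2 : (B (x - u • p) (x - u • p)).re = (B x x).re + (B p p).re - 2 * ‖B x p‖ := by
      have e1 : B p x = starRingEnd ℂ (B x p) := (h.hermitian _ _).symm
      have e2 : starRingEnd ℂ u * u = 1 := by
        rw [mul_comm, Complex.mul_conj, Complex.normSq_eq_norm_sq, hu]; norm_num
      have e3 : starRingEnd ℂ u * B p x = ‖B x p‖ := by
        rw [e1, ← map_mul, ← hu']; simp
      have e4 : B (x - u • p) (x - u • p) = B x x + B p p - 2 * ‖B x p‖ := by
        simp only [map_sub, LinearMap.sub_apply, map_smulₛₗ, LinearMap.smul_apply, smul_eq_mul,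
          RingHom.id_apply]
        linear_combination hu' - e3 + B p p * e2
      rw [e4]; simp
    linarith
  refine ⟨1 / (C ^ 2 + 1), by positivity, fun x hx => ?_⟩
  rw [one_div, inv_mul_le_iff₀ (by positivity)]
  rcases eq_or_ne x 0 with rfl | hx0
  · simp
  have hb := hD.hilbert_pos.pos x hx hx0
  set b := (B x x).re with hbdef
  have hs := Real.mul_self_sqrt hb.le
  have hs0 := Real.sqrt_pos.2 hb
  have h1 := hC ⟨((Real.sqrt b)⁻¹ : ℂ) • x, Hp.smul_mem _ hx, by
    have : (B (((Real.sqrt b)⁻¹ : ℂ) • x) (((Real.sqrt b)⁻¹ : ℂ) • x)).re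
        = (Real.sqrt b)⁻¹ * ((Real.sqrt b)⁻¹ * b) := by
      rw [← Complex.ofReal_inv]
      simp [hbdef]
    rw [this, ← mul_assoc, ← mul_inv, hs, inv_mul_cancel₀ hb.ne']⟩
  change ‖innerSL ℂ (((Real.sqrt b)⁻¹ : ℂ) • x)‖ ≤ C at h1
  rw [innerSL_apply_norm, norm_smul, ← Complex.ofReal_inv, Complex.norm_real,
    Real.norm_of_nonneg (by positivity), inv_mul_le_iff₀ hs0] at h1
  have h2 : ‖x‖ ^ 2 ≤ (Real.sqrt b * C) ^ 2 := pow_le_pow_left₀ (norm_nonneg _) h1 2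
  nlinarith

/-- In a larger uniformly positive subspace, the `Hm` component of any vector would lie in that
subspace too, and being both negative and nonnegative it vanishes. -/
theorem IsFundamentalDecomposition.maximal_left [CompleteSpace H] {Hp Hm : Submodule ℂ H}
    (h : IsFundamentalSymmetry B J) (hD : IsFundamentalDecomposition B Hp Hm) :
    Maximal (IsUniformlyPositive B) Hp := by
  refine ⟨hD.isUniformlyPositive h, fun M ⟨α, hα, hM⟩ hle x hx => ?_⟩
  obtain ⟨p, hp, m, hm, rfl⟩ : ∃ p ∈ Hp, ∃ m ∈ Hm, p + m = x :=
    Submodule.mem_sup.1 (hD.isCompl.sup_eq_top ▸ Submodule.mem_top)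
  have hmM : m ∈ M := by simpa using M.sub_mem hx (hle hp)
  have : m = 0 := by
    by_contra h0
    have h1 := hD.hilbert_neg.pos m hm h0
    have h2 := hM m hmM
    have h3 : 0 ≤ α * ‖m‖ ^ 2 := by positivity
    simp only [LinearMap.neg_apply, Complex.neg_re] at h1
    linarith
  rwa [this, add_zero]

theorem IsFundamentalDecomposition.maximal_right [CompleteSpace H] {Hp Hm : Submodule ℂ H}
    (h : IsFundamentalSymmetry B J) (hD : IsFundamentalDecomposition B Hp Hm) :
    Maximal (IsUniformlyNegative B) Hm := by
  rw [isUniformlyNegative_eq]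
  exact (hD.neg h).maximal_left h.neg

theorem IsUniformlyPositive.topologicalClosure (h : IsFundamentalSymmetry B J)
    {M : Submodule ℂ H} (hM : IsUniformlyPositive B M) :
    IsUniformlyPositive B M.topologicalClosure := by
  obtain ⟨α, hα, hM⟩ := hM
  refine ⟨α, hα, fun x hx => ?_⟩
  exact closure_minimal (t := {x | α * ‖x‖ ^ 2 ≤ (B x x).re}) hM
    (isClosed_le (by fun_prop) h.continuous_form) hx

theorem IsUniformlyPositive.isClosed_of_maximal (h : IsFundamentalSymmetry B J)
    {M : Submodule ℂ H} (hM : Maximal (IsUniformlyPositive B) M) : IsClosed (M : Set H) := by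
  have := hM.2 (hM.1.topologicalClosure h) M.le_topologicalClosure
  rw [le_antisymm M.le_topologicalClosure this]
  exact M.isClosed_topologicalClosure

/-- Adding a fixed vector of `J` that is orthogonal to the projection of `M` keeps a subspace `M`
uniformly positive. -/
theorem IsUniformlyPositive.sup_span (h : IsFundamentalSymmetry B J) {M : Submodule ℂ H}
    (hM : IsUniformlyPositive B M) {k : H} (hk : k ∈ fixed J)
    (hk' : ∀ m ∈ M, inner ℂ (posProj J m) k = 0) :
    IsUniformlyPositive B (M ⊔ Submodule.span ℂ {k}) := by
  obtain ⟨α, hα, hM⟩ := hM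
  -- The factor 1/2 pays for `‖m + t • k‖² ≤ 2 (‖m‖² + ‖t • k‖²)`.
  refine ⟨min α 1 / 2, by positivity, fun x hx => ?_⟩
  obtain ⟨m, hm, y, hy, rfl⟩ := Submodule.mem_sup.1 hx
  obtain ⟨t, rfl⟩ := Submodule.mem_span_singleton.1 hy
  have hy' : t • k ∈ fixed J := (fixed J).smul_mem t hk
  have h0 : inner ℂ (posProj J m) (t • k) = 0 := by rw [inner_smul_right, hk' m hm, mul_zero]
  have h1 : ‖posProj J m + t • k‖ ^ 2 = ‖posProj J m‖ ^ 2 + ‖t • k‖ ^ 2 := by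
    rw [@_root_.norm_add_sq ℂ, h0]; simp
  have h2 : posProj (-J) (t • k) = 0 := by
    have := add_posProj J (t • k)
    rwa [posProj_eq hy', add_eq_left] at this
  have h3 : (B (m + t • k) (m + t • k)).re = (B m m).re + ‖t • k‖ ^ 2 := by
    rw [h.form_self_eq, h.form_self_eq m, map_add, map_add, h2, posProj_eq hy', h1, add_zero]
    ring
  have h4 := hM m hm
  have h5 : ‖m + t • k‖ ^ 2 ≤ 2 * (‖m‖ ^ 2 + ‖t • k‖ ^ 2) := by
    have := parallelogram_law_with_norm ℂ m (t • k)
    nlinarith [sq_nonneg ‖m - t • k‖]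
  have h6 : min α 1 * ‖m‖ ^ 2 ≤ α * ‖m‖ ^ 2 := by gcongr; exact min_le_left _ _
  have h7 : min α 1 * ‖t • k‖ ^ 2 ≤ 1 * ‖t • k‖ ^ 2 := by gcongr; exact min_le_right _ _
  have h8 : 0 < min α 1 := by positivity
  rw [h3]
  nlinarith

/-- A maximal uniformly positive subspace is the graph of a strict contraction from the positive
part to the negative part of the fundamental decomposition. -/
theorem IsUniformlyPositive.exists_contraction [CompleteSpace H] (h : IsFundamentalSymmetry B J)
    {M : Submodule ℂ H} (hM : Maximal (IsUniformlyPositive B) M) :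
    ∃ (D : H →L[ℂ] H) (a : ℝ), 0 ≤ a ∧ a < 1 ∧ (∀ x, D x ∈ fixed (-J)) ∧
      (∀ x, ‖D x‖ ^ 2 ≤ a * ‖posProj J x‖ ^ 2) ∧ (∀ x, posProj J x + D x ∈ M) ∧
      ∀ m ∈ M, D m = posProj (-J) m := by
  have hcl := isClosed_of_maximal h hM
  obtain ⟨α, hα, hMα⟩ := hM.1
  have hlow : ∀ m ∈ M, α * ‖m‖ ^ 2 ≤ ‖posProj J m‖ ^ 2 := fun m hm => by
    have h1 := hMα m hm
    rw [h.form_self_eq] at h1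
    nlinarith [sq_nonneg ‖posProj (-J) m‖]
  have hcont : ∀ m ∈ M, ‖posProj (-J) m‖ ^ 2 ≤ (1 - α) * ‖posProj J m‖ ^ 2 := fun m hm => by
    have h1 := hMα m hm
    rw [h.form_self_eq, h.norm_sq_eq] at h1
    nlinarith [mul_nonneg hα.le (sq_nonneg ‖posProj (-J) m‖)]
  let P : M →L[ℂ] H := (posProj J).comp M.subtypeL
  have : CompleteSpace M := hcl.completeSpace_coe
  have hanti : AntilipschitzWith (Real.toNNReal (Real.sqrt α)⁻¹) P := by
    refine P.antilipschitz_of_bound fun m => ?_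
    rw [Real.coe_toNNReal _ (by positivity), ← div_eq_inv_mul, le_div_iff₀ (by positivity)]
    refine le_of_sq_le_sq ?_ (by positivity)
    rw [mul_pow, Real.sq_sqrt hα.le, mul_comm]
    exact hlow m m.2
  have hrcl : IsClosed (Set.range P) := hanti.isClosed_range P.uniformContinuous
  let N : Submodule ℂ H := LinearMap.range (P : M →ₗ[ℂ] H)
  have hNcl : IsClosed (N : Set H) := hrcl
  have : CompleteSpace N := hNcl.completeSpace_coe
  -- The projection of `M` fills the eigenspace: a vector `k` of it orthogonal to the closed range
  -- `N` can be adjoined to `M`, so lies in `M` by maximality, hence in `N`, and is zero.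
  have hsurj : ∀ x ∈ fixed J, ∃ m : M, P m = x := by
    intro x hx
    have hxN : N.starProjection x ∈ N := N.starProjection_apply_mem x
    have hNfix : N ≤ fixed J := by
      rintro _ ⟨m, rfl⟩
      exact h.posProj_mem _
    set k := x - N.starProjection x with hk
    have hkJ : k ∈ fixed J := (fixed J).sub_mem hx (hNfix hxN)
    have hkN : k ∈ Nᗮ := N.sub_starProjection_mem_orthogonal x
    have hkM : k ∈ M := by
      refine hM.2 (hM.1.sup_span h hkJ fun m hm => ?_) le_sup_left
        ((le_sup_right : _ ≤ M ⊔ _) (Submodule.mem_span_singleton_self k))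
      exact (Submodule.mem_orthogonal _ _).1 hkN _ ⟨⟨m, hm⟩, rfl⟩
    have hk0 : k = 0 := by
      have : k ∈ N := ⟨⟨k, hkM⟩, posProj_eq hkJ⟩
      exact inner_self_eq_zero.1 ((Submodule.mem_orthogonal _ _).1 hkN k this)
    rw [hk, sub_eq_zero] at hk0
    rw [hk0]
    exact hxN
  let P₀ : M →ₗ[ℂ] fixed J := (P : M →ₗ[ℂ] H).codRestrict (fixed J) fun m => h.posProj_mem _
  have hbij : Function.Bijective P₀ := by
    refine ⟨fun a b hab => hanti.injective (congrArg Subtype.val hab), fun ⟨x, hx⟩ => ?_⟩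
    obtain ⟨m, hm⟩ := hsurj x hx
    exact ⟨m, Subtype.ext hm⟩
  let e := LinearEquiv.ofBijective P₀ hbij
  let R : H →ₗ[ℂ] M := e.symm.toLinearMap ∘ₗ
    ((posProj J : H →L[ℂ] H) : H →ₗ[ℂ] H).codRestrict (fixed J) h.posProj_mem
  have hR : ∀ x, posProj J (R x : H) = posProj J x := fun x =>
    congrArg Subtype.val (e.apply_symm_apply
      (((posProj J : H →L[ℂ] H) : H →ₗ[ℂ] H).codRestrict (fixed J) h.posProj_mem x))
  have hRM : ∀ m : M, R m = m := fun m => hanti.injective (hR m)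
  let D₀ : H →ₗ[ℂ] H := ((posProj (-J) : H →L[ℂ] H) : H →ₗ[ℂ] H) ∘ₗ M.subtype ∘ₗ R
  have hD₀ : ∀ x, D₀ x = posProj (-J) (R x : H) := fun x => rfl
  -- The maximum covers `α > 1`, which is possible when `M` is trivial.
  have hbd : ∀ x, ‖D₀ x‖ ^ 2 ≤ max (1 - α) 0 * ‖posProj J x‖ ^ 2 := fun x => by
    rw [hD₀, ← hR x]
    exact (hcont _ (R x).2).trans (by gcongr; exact le_max_left _ _)
  have hbd' : ∀ x, ‖D₀ x‖ ≤ 1 * ‖x‖ := fun x => by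
    refine le_of_sq_le_sq ((hbd x).trans ?_) (by positivity)
    rw [one_mul, h.norm_sq_eq x]
    have : max (1 - α) 0 ≤ 1 := max_le (by linarith) zero_le_one
    nlinarith [sq_nonneg ‖posProj J x‖, sq_nonneg ‖posProj (-J) x‖]
  refine ⟨D₀.mkContinuous 1 hbd', max (1 - α) 0, le_max_right _ _,
    max_lt (by linarith) one_pos, fun x => h.neg.posProj_mem _, hbd, fun x => ?_, fun m hm => ?_⟩
  · change posProj J x + D₀ x ∈ M
    rw [hD₀, ← hR, add_posProj]
    exact (R x).2
  · change D₀ m = _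
    rw [hD₀, hRM ⟨m, hm⟩]

/-- Nonzero vectors in the parts of a fundamental decomposition determine the partition of the
index set. -/
theorem IsFundamentalDecomposition.index_eq {Hp Hm : Submodule ℂ H}
    (hD : IsFundamentalDecomposition B Hp Hm) 
    {I : Type*} {f q : I → H}
    (hp : ∀ i ∈ indexPos B f, q i ∈ Hp) (hm : ∀ i ∈ indexNeg B f, q i ∈ Hm)
    (h0 : ∀ i, q i = 0 → f i = 0) :
    indexPos B q = indexPos B f ∧ indexNeg B q = indexNeg B f := by
  have e1 : ∀ i ∈ indexPos B f, i ∈ indexPos B q := fun i hi => by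
    change 0 ≤ (B (q i) (q i)).re
    rcases eq_or_ne (q i) 0 with hq | hq
    · simp [hq]
    · exact (hD.hilbert_pos.pos _ (hp i hi) hq).le
  have e2 : ∀ i ∈ indexNeg B f, i ∈ indexNeg B q := fun i hi => by
    -- Zero vectors are counted in `I₊`, so a negative index needs `q i ≠ 0`; this is where `h0`
    -- enters.
    have hq : q i ≠ 0 := fun hq => by
      have hi' : (B (f i) (f i)).re < 0 := hi
      simp [h0 i hq] at hi'
    have := hD.hilbert_neg.pos _ (hm i hi) hq
    simpa [indexNeg] using this
  have e3 : indexPos B q = indexPos B f := by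
    refine Set.Subset.antisymm (fun i hi => ?_) e1
    by_contra hn
    have := e2 i (by rwa [← indexPos_compl])
    rw [← indexPos_compl] at this
    exact this hi
  exact ⟨e3, by rw [← indexPos_compl, ← indexPos_compl, e3]⟩

end Definite

/-! ### Straightening operators and inverse square roots -/

section Operators

variable {H : Type*} [NormedAddCommGroup H] [InnerProductSpace ℂ H] [CompleteSpace H]
  {B : H →ₗ⋆[ℂ] H →ₗ[ℂ] ℂ} {J : H →L[ℂ] H}

open IsFundamentalSymmetry

/-- An invertible operator moves the fundamental decomposition given by `J` onto any pair of a
maximal uniformly positive and a maximal uniformly negative subspace. -/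
theorem IsFundamentalSymmetry.exists_unit_map (h : IsFundamentalSymmetry B J)
    {Mp Mm : Submodule ℂ H} (hp : Maximal (IsUniformlyPositive B) Mp)
    (hm : Maximal (IsUniformlyNegative B) Mm) :
    ∃ W : (H →L[ℂ] H)ˣ, (∀ x ∈ fixed J, W.1 x ∈ Mp) ∧ (∀ x ∈ fixed (-J), W.1 x ∈ Mm) ∧
      (∀ m ∈ Mp, W⁻¹.1 m ∈ fixed J) ∧ ∀ m ∈ Mm, W⁻¹.1 m ∈ fixed (-J) := by
  rw [isUniformlyNegative_eq] at hm
  obtain ⟨D, a, ha0, ha1, hD1, hD2, hD3, hD4⟩ := IsUniformlyPositive.exists_contraction h hp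
  obtain ⟨E, b, hb0, hb1, hE1, hE2, hE3, hE4⟩ := IsUniformlyPositive.exists_contraction h.neg hm
  rw [neg_neg] at hE1 hE4
  have hD0 : ∀ x ∈ fixed (-J), D x = 0 := fun x hx => by
    have := hD2 x
    rw [posProj_eq_zero hx] at this
    simpa using le_antisymm (this.trans (by simp)) (sq_nonneg _)
  have hE0 : ∀ x ∈ fixed J, E x = 0 := fun x hx => by
    have := hE2 x
    rw [posProj_eq_zero (by rwa [neg_neg])] at this
    simpa using le_antisymm (this.trans (by simp)) (sq_nonneg _)
  -- `D` and `E` depend on complementary components of `x` and have orthogonal ranges, so their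
  -- squared bounds add without loss.
  have hN : ‖-(D + E)‖ < 1 := by
    set c := max a b
    have hc : c < 1 := max_lt ha1 hb1
    have hc0 : 0 ≤ c := ha0.trans (le_max_left _ _)
    refine lt_of_le_of_lt (ContinuousLinearMap.opNorm_le_bound _ (Real.sqrt_nonneg c) fun x => ?_)
      (by rw [← Real.sqrt_one]; exact Real.sqrt_lt_sqrt hc0 hc)
    refine le_of_sq_le_sq ?_ (by positivity)
    rw [mul_pow, Real.sq_sqrt hc0, neg_apply, norm_neg, add_apply, add_comm,
      h.norm_add_sq (hE1 x) (hD1 x), h.norm_sq_eq x]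
    have h1 : a * ‖posProj J x‖ ^ 2 ≤ c * ‖posProj J x‖ ^ 2 := by
      gcongr; exact le_max_left _ _
    have h2 : b * ‖posProj (-J) x‖ ^ 2 ≤ c * ‖posProj (-J) x‖ ^ 2 := by
      gcongr; exact le_max_right _ _
    linarith [hD2 x, hE2 x]
  let W := Units.oneSub (-(D + E)) hN
  have hW : ∀ x, W.1 x = x + (D x + E x) := fun x => by
    simp only [W, Units.val_oneSub, sub_neg_eq_add, add_apply, one_apply_eq_self]
  refine ⟨W, fun x hx => ?_, fun x hx => ?_, fun m hm => ?_, fun m hm => ?_⟩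
  · rw [hW, hE0 x hx, add_zero]
    simpa [posProj_eq hx] using hD3 x
  · rw [hW, hD0 x hx, zero_add]
    simpa [posProj_eq hx] using hE3 x
  · have : W.1 (posProj J m) = m := by
      have h1 : D m = D (posProj J m) := by
        conv_lhs => rw [← add_posProj J m, map_add, hD0 _ (h.neg.posProj_mem m), add_zero]
      rw [hW, hE0 _ (h.posProj_mem m), add_zero, ← h1, hD4 m hm, add_posProj]
    rw [← this, unit_inv_apply_apply]
    exact h.posProj_mem m
  · have : W.1 (posProj (-J) m) = m := by
      have h1 : E m = E (posProj (-J) m) := by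
        conv_lhs => rw [← add_posProj J m, map_add, hE0 _ (h.posProj_mem m), zero_add]
      rw [hW, hD0 _ (h.neg.posProj_mem m), zero_add, ← h1, hE4 m hm, add_comm, add_posProj]
    rw [← this, unit_inv_apply_apply]
    exact h.neg.posProj_mem m

/-- Inverse square roots of self-adjoint operators that are bounded below. -/
theorem exists_inv_sqrt (A : H →L[ℂ] H) (hA : ∀ x y, inner ℂ (A x) y = inner ℂ x (A y)) {c : ℝ}
    (hc : 0 < c) (hAc : ∀ x, c * ‖x‖ ^ 2 ≤ (inner ℂ (A x) x).re) (hAJ : Commute A J) :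
    ∃ R : (H →L[ℂ] H)ˣ, star R.1 = R.1 ∧ R.1 * A * R.1 = 1 ∧ Commute R.1 J := by
  have hpos : (0 : H →L[ℂ] H) ≤ A := by
    rw [ContinuousLinearMap.nonneg_iff_isPositive]
    exact ⟨hA, fun x => (by positivity : 0 ≤ c * ‖x‖ ^ 2).trans (hAc x)⟩
  have hunit : IsUnit A := by
    refine A.isUnit_of_forall_le_norm_inner_map (c := ⟨c, hc.le⟩) hc fun x => ?_
    refine le_trans ?_ (Complex.re_le_norm _)
    rw [mul_comm]
    exact hAc x
  have hs : IsStrictlyPositive A := ⟨hpos, hunit⟩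
  obtain ⟨R, hR⟩ : IsUnit (A ^ (-(1 / 2) : ℝ)) := (hs.rpow A _).isUnit
  refine ⟨R, ?_, ?_, ?_⟩
  · rw [hR]
    exact (IsSelfAdjoint.of_nonneg CFC.rpow_nonneg).star_eq
  · rw [hR]
    exact CFC.conjugate_rpow_neg_one_half A hs
  · rw [hR, CFC.rpow_def]
    exact hAJ.cfc_nnreal _

end Operators

/-! ### Synthesis operators and their Hilbert space adjoints -/

section Synthesis

variable {H : Type*} [NormedAddCommGroup H] [InnerProductSpace ℂ H] [CompleteSpace H] {I : Type*}

theorem synthesis_apply {f : I → H} (hf : IsBessel f) (x : L2 I) :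
    synthesis f hf x = ∑' i, x i • f i := rfl

theorem synthesis_single [DecidableEq I] {f : I → H} (hf : IsBessel f) (i : I) :
    synthesis f hf (lp.single 2 i (1 : ℂ)) = f i := by
  rw [synthesis_apply, tsum_eq_single i fun j hj => by rw [lp.single_apply_ne _ _ _ hj, zero_smul],
    lp.single_apply_self, one_smul]

theorem adjoint_synthesis_apply {f : I → H} (hf : IsBessel f) (y : H) (i : I) :
    ContinuousLinearMap.adjoint (synthesis f hf) y i = inner ℂ (f i) y := by
  classical
  rw [← synthesis_single hf i, ← ContinuousLinearMap.adjoint_inner_right,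
    lp.inner_single_left]
  simp

theorem IsBessel.map {f : I → H} (hf : IsBessel f) (V : H →L[ℂ] H) :
    IsBessel fun i => V (f i) := by
  obtain ⟨β, hβ, hf⟩ := hf
  refine ⟨β * (‖V‖ ^ 2 + 1), by positivity, fun x => ?_⟩
  have e : ∀ i, inner ℂ (V (f i)) x = inner ℂ (f i) (ContinuousLinearMap.adjoint V x) :=
    fun i => (ContinuousLinearMap.adjoint_inner_right V (f i) x).symm
  simp only [e]
  refine ⟨(hf _).1, (hf _).2.trans ?_⟩
  rw [mul_assoc]
  gcongr
  have h1 : ‖ContinuousLinearMap.adjoint V x‖ ≤ ‖V‖ * ‖x‖ := by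
    rw [← (ContinuousLinearMap.adjoint : (H →L[ℂ] H) ≃ₗᵢ⋆[ℂ] _).norm_map V]
    exact ContinuousLinearMap.le_opNorm _ _
  calc ‖ContinuousLinearMap.adjoint V x‖ ^ 2 ≤ (‖V‖ * ‖x‖) ^ 2 :=
        pow_le_pow_left₀ (norm_nonneg _) h1 2
    _ ≤ _ := by nlinarith [sq_nonneg ‖x‖]

theorem synthesis_map {f : I → H} (hf : IsBessel f) (V : H →L[ℂ] H)
    (hV : IsBessel fun i => V (f i)) (x : L2 I) :
    synthesis (fun i => V (f i)) hV x = V (synthesis f hf x) := by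
  rw [synthesis_apply, synthesis_apply, V.map_tsum (hf.summable x)]
  simp

theorem mem_map_synthesis [DecidableEq I] {f : I → H} (hf : IsBessel f) {A : Set I} {i : I}
    (hi : i ∈ A) : f i ∈ (L2.supportedOn A).map (synthesis f hf : L2 I →ₗ[ℂ] H) :=
  ⟨lp.single 2 i (1 : ℂ), fun _ hj => lp.single_apply_ne _ _ _ fun e => hj (e ▸ hi),
    synthesis_single hf i⟩

/-- By the open mapping theorem `y = T x` with `‖x‖ ≤ C ‖y‖`, and then `‖y‖² = ⟨x, T* y⟩`. This is
the lower frame bound. -/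
theorem exists_pos_adjoint_norm_le {T : L2 I →L[ℂ] H} (hT : Function.Surjective T) :
    ∃ c : ℝ, 0 < c ∧ ∀ y, c * ‖y‖ ^ 2 ≤ ‖ContinuousLinearMap.adjoint T y‖ ^ 2 := by
  obtain ⟨C, hC, h⟩ := T.exists_preimage_norm_le hT
  refine ⟨1 / C ^ 2, by positivity, fun y => ?_⟩
  obtain ⟨x, rfl, hx⟩ := h y
  set y := T x with hy
  have h1 : ‖y‖ ^ 2 ≤ ‖x‖ * ‖ContinuousLinearMap.adjoint T y‖ := by
    have : ‖y‖ ^ 2 = ‖(inner ℂ x (ContinuousLinearMap.adjoint T y) : ℂ)‖ := by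
      rw [ContinuousLinearMap.adjoint_inner_right, ← hy, inner_self_eq_norm_sq_to_K]; simp
    rw [this]
    exact norm_inner_le_norm _ _
  have h2 : ‖y‖ ≤ C * ‖ContinuousLinearMap.adjoint T y‖ := by
    rcases (norm_nonneg y).eq_or_lt with h0 | h0
    · rw [← h0]; positivity
    · have : ‖x‖ * ‖ContinuousLinearMap.adjoint T y‖
          ≤ C * ‖y‖ * ‖ContinuousLinearMap.adjoint T y‖ := by gcongr
      nlinarith
  rw [one_div, inv_mul_le_iff₀ (by positivity), ← mul_pow]
  exact pow_le_pow_left₀ (norm_nonneg _) h2 2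

end Synthesis

/-! ### The Krein space adjoint of the synthesis operator -/

section Parseval

variable {H : Type*} [NormedAddCommGroup H] [InnerProductSpace ℂ H] [CompleteSpace H] {I : Type*}
  {B : H →ₗ⋆[ℂ] H →ₗ[ℂ] ℂ} {J : H →L[ℂ] H}

/-- If `A` acts on the vectors of `f` by the signs of the partition of the index set, then
`T* A* J` is the adjoint of the synthesis operator `T` in the sense of Krein spaces. -/
theorem isKreinAdjoint_synthesis (h : IsFundamentalSymmetry B J) {f : I → H} (hf : IsBessel f)
    (A : H →L[ℂ] H) (hp : ∀ i ∈ indexPos B f, A (f i) = f i)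
    (hm : ∀ i ∈ indexNeg B f, A (f i) = -f i) :
    IsKreinAdjoint (L2.indefinite B f) (fun x y => B x y) (synthesis f hf)
      (ContinuousLinearMap.adjoint (synthesis f hf) ∘L star A ∘L J) := by
  intro x y
  set w := ContinuousLinearMap.adjoint (synthesis f hf) (J y) with hw
  have hz : ∀ i, (ContinuousLinearMap.adjoint (synthesis f hf) ∘L star A ∘L J) y i
      = inner ℂ (A (f i)) (J y) := fun i => by
    change ContinuousLinearMap.adjoint (synthesis f hf) (star A (J y)) i = _
    rw [adjoint_synthesis_apply, ContinuousLinearMap.star_eq_adjoint,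
      ContinuousLinearMap.adjoint_inner_right]
  have hwi : ∀ i, w i = inner ℂ (f i) (J y) := fun i => adjoint_synthesis_apply hf _ i
  have hs := lp.hasSum_inner (𝕜 := ℂ) x w
  have hs' : HasSum (fun i => starRingEnd ℂ (x i) * w i) (inner ℂ x w) := by
    simpa [mul_comm] using hs
  have e1 : ∑' i : indexPos B f, starRingEnd ℂ (x i) *
      (ContinuousLinearMap.adjoint (synthesis f hf) ∘L star A ∘L J) y i
      = ∑' i : indexPos B f, starRingEnd ℂ (x i) * w i :=
    tsum_congr fun i => by rw [hz, hp i i.2, hwi]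
  have e2 : ∑' i : indexNeg B f, starRingEnd ℂ (x i) *
      (ContinuousLinearMap.adjoint (synthesis f hf) ∘L star A ∘L J) y i
      = -∑' i : indexNeg B f, starRingEnd ℂ (x i) * w i := by
    rw [← tsum_neg]
    exact tsum_congr fun i => by rw [hz, hm i i.2, hwi, inner_neg_left, mul_neg]
  have e3 : (∑' i : indexPos B f, starRingEnd ℂ (x i) * w i) +
      ∑' i : indexNeg B f, starRingEnd ℂ (x i) * w i = inner ℂ x w := by
    rw [← hs'.tsum_eq, ← indexPos_compl]
    exact (hs'.summable.subtype _).tsum_add_tsum_compl (hs'.summable.subtype _)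
  change B (synthesis f hf x) y = _ - _
  rw [e1, e2, sub_neg_eq_add, h.form_eq, h.symmetric, ← ContinuousLinearMap.adjoint_inner_right]
  exact e3.symm

end Parseval

/-! ### Pulling the form back along an operator -/

section Similarity

variable {H : Type*} [NormedAddCommGroup H] [InnerProductSpace ℂ H] [CompleteSpace H]
  {B : H →ₗ⋆[ℂ] H →ₗ[ℂ] ℂ} {J : H →L[ℂ] H}

theorem IsFundamentalSymmetry.star_eq (h : IsFundamentalSymmetry B J) : star J = J := by
  rw [ContinuousLinearMap.star_eq_adjoint]
  exact ((ContinuousLinearMap.eq_adjoint_iff J J).2 h.symmetric).symm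

open IsFundamentalSymmetry

theorem inner_star_mul_mul (U : H →L[ℂ] H) (h : IsFundamentalSymmetry B J) (x y : H) :
    inner ℂ ((star U * J * U) x) y = B (U x) (U y) := by
  rw [h.form_eq, mul_apply_eq_comp, mul_apply_eq_comp, ContinuousLinearMap.star_eq_adjoint,
    ContinuousLinearMap.adjoint_inner_left]

/-- The pullback of the form by an operator that maps the fundamental decomposition given by `J`
into another one. -/
theorem IsFundamentalDecomposition.commute_pullback (h : IsFundamentalSymmetry B J)
    {Hp Hm : Submodule ℂ H} (hD : IsFundamentalDecomposition B Hp Hm) {U : H →L[ℂ] H}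
    (hp : ∀ x ∈ fixed J, U x ∈ Hp) (hm : ∀ x ∈ fixed (-J), U x ∈ Hm) :
    Commute (star U * J * U) J := by
  have key : ∀ x ∈ fixed J, ∀ y ∈ fixed (-J), B (U x) (U y) = 0 := fun x hx y hy =>
    hD.orthogonal _ (hp x hx) _ (hm y hy)
  have key' : ∀ x ∈ fixed J, ∀ y ∈ fixed (-J), B (U y) (U x) = 0 := fun x hx y hy => by
    rw [← h.hermitian, key x hx y hy, map_zero]
  refine ContinuousLinearMap.ext fun x => ext_inner_right ℂ fun y => ?_
  rw [mul_apply_eq_comp, mul_apply_eq_comp J, inner_star_mul_mul U h, h.symmetric,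
    inner_star_mul_mul U h]
  have hx1 := h.posProj_mem x
  have hx2 := h.neg.posProj_mem x
  have hy1 := h.posProj_mem y
  have hy2 := h.neg.posProj_mem y
  rw [← add_posProj J x, ← add_posProj J y]
  simp only [map_add, mem_fixed.1 hx1, mem_fixed_neg.1 hx2, mem_fixed.1 hy1, mem_fixed_neg.1 hy2,
    LinearMap.add_apply, map_neg, LinearMap.neg_apply, key _ hx1 _ hy2, key' _ hy1 _ hx2]
  simp

/-- The last factor `J` flips the sign on the negative eigenspace, so the quadratic form of `star U
* J * U * J` is `B` on the image in `Hp` plus `-B` on the image in `Hm`. Both are bounded below by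
uniform definiteness. -/
theorem IsFundamentalDecomposition.exists_inv_sqrt_pullback (h : IsFundamentalSymmetry B J)
    {Hp Hm : Submodule ℂ H} (hD : IsFundamentalDecomposition B Hp Hm) (U : (H →L[ℂ] H)ˣ)
    (hp : ∀ x ∈ fixed J, U.1 x ∈ Hp) (hm : ∀ x ∈ fixed (-J), U.1 x ∈ Hm) :
    ∃ R : (H →L[ℂ] H)ˣ, star R.1 = R.1 ∧ R.1 * (star U.1 * J * U.1 * J) * R.1 = 1 ∧
      Commute R.1 J := by
  have hcomm := hD.commute_pullback h hp hm
  obtain ⟨α, hα, hpα⟩ := hD.isUniformlyPositive h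
  obtain ⟨β, hβ, hmβ⟩ := (hD.neg h).isUniformlyPositive h.neg
  obtain ⟨c, hc, hcU⟩ : ∃ c : ℝ, 0 < c ∧ ∀ x, c * ‖x‖ ^ 2 ≤ ‖U.1 x‖ ^ 2 := by
    refine ⟨1 / (‖U⁻¹.1‖ ^ 2 + 1), by positivity, fun x => ?_⟩
    rw [one_div, inv_mul_le_iff₀ (by positivity)]
    have h1 := U⁻¹.1.le_opNorm (U.1 x)
    rw [unit_inv_apply_apply] at h1
    have h2 := pow_le_pow_left₀ (norm_nonneg _) h1 2
    nlinarith [sq_nonneg ‖U.1 x‖]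
  have hin : ∀ x y, inner ℂ ((star U.1 * J * U.1 * J) x) y = B (U.1 (J x)) (U.1 y) :=
    fun x y => by rw [mul_apply_eq_comp, inner_star_mul_mul U.1 h]
  refine exists_inv_sqrt _ (fun x y => ?_) (c := min α β * c) (by positivity) (fun x => ?_)
    (hcomm.mul_left (Commute.refl J))
  · rw [hin, ← inner_conj_symm, hin, h.hermitian, ← inner_star_mul_mul U.1 h,
      ← inner_star_mul_mul U.1 h, ← h.symmetric, ← mul_apply_eq_comp, hcomm.eq, mul_apply_eq_comp]
  · have hx1 := h.posProj_mem x
    have hx2 := h.neg.posProj_mem x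
    have e1 := hpα _ (hp _ hx1)
    have e2 := hmβ _ (hm _ hx2)
    have e3 : B (U.1 (posProj J x)) (U.1 (posProj (-J) x)) = 0 :=
      hD.orthogonal _ (hp _ hx1) _ (hm _ hx2)
    have e4 : B (U.1 (posProj (-J) x)) (U.1 (posProj J x)) = 0 := by
      rw [← h.hermitian, e3, map_zero]
    have e5 := hcU (posProj J x)
    have e6 := hcU (posProj (-J) x)
    have e7 : (inner ℂ ((star U.1 * J * U.1 * J) x) x).re
        = (B (U.1 (posProj J x)) (U.1 (posProj J x))).re
        + ((-B) (U.1 (posProj (-J) x)) (U.1 (posProj (-J) x))).re := by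
      rw [hin]
      conv_lhs => rw [← add_posProj J x]
      simp only [map_add, mem_fixed.1 hx1, mem_fixed_neg.1 hx2, LinearMap.add_apply, map_neg,
        LinearMap.neg_apply, e3, e4]
      simp
    rw [e7, h.norm_sq_eq x]
    have h1 : min α β * (c * ‖posProj J x‖ ^ 2)
        ≤ α * ‖U.1 (posProj J x)‖ ^ 2 :=
      mul_le_mul (min_le_left _ _) e5 (by positivity) hα.le
    have h2 : min α β * (c * ‖posProj (-J) x‖ ^ 2)
        ≤ β * ‖U.1 (posProj (-J) x)‖ ^ 2 :=
      mul_le_mul (min_le_right _ _) e6 (by positivity) hβ.le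
    linarith

end Similarity

/-! ### The frame operator and the Parseval identity -/

section FrameOperator

variable {H : Type*} [NormedAddCommGroup H] [InnerProductSpace ℂ H] [CompleteSpace H] {I : Type*}
  {B : H →ₗ⋆[ℂ] H →ₗ[ℂ] ℂ} {J : H →L[ℂ] H}

open IsFundamentalSymmetry

/-- Each rank one term `⟨gᵢ, ·⟩ gᵢ` commutes with `J`, because the eigenvalue ±1 of `gᵢ` can be
moved from one factor to the other. -/
theorem commute_synthesis_mul_adjoint (h : IsFundamentalSymmetry B J) {g : I → H}
    (hg : IsBessel g) (hJ : ∀ i, g i ∈ fixed J ∨ g i ∈ fixed (-J)) :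
    Commute (synthesis g hg ∘L ContinuousLinearMap.adjoint (synthesis g hg)) J := by
  refine ContinuousLinearMap.ext fun x => ?_
  change synthesis g hg (ContinuousLinearMap.adjoint (synthesis g hg) (J x))
    = J (synthesis g hg (ContinuousLinearMap.adjoint (synthesis g hg) x))
  rw [synthesis_apply, synthesis_apply, J.map_tsum (hg.summable _)]
  refine tsum_congr fun i => ?_
  rw [adjoint_synthesis_apply, adjoint_synthesis_apply, map_smul, ← h.symmetric]
  rcases hJ i with hi | hi
  · rw [mem_fixed.1 hi]
  · rw [mem_fixed_neg.1 hi, inner_neg_left, neg_smul, smul_neg]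

theorem exists_inv_sqrt_frameOperator (h : IsFundamentalSymmetry B J) {g : I → H}
    (hg : IsBessel g) (hJ : ∀ i, g i ∈ fixed J ∨ g i ∈ fixed (-J))
    (hsurj : Function.Surjective (synthesis g hg)) :
    ∃ R : (H →L[ℂ] H)ˣ, star R.1 = R.1 ∧
      R.1 * (synthesis g hg ∘L ContinuousLinearMap.adjoint (synthesis g hg)) * R.1 = 1 ∧
      Commute R.1 J := by
  obtain ⟨c, hc, hlow⟩ := exists_pos_adjoint_norm_le hsurj
  refine exists_inv_sqrt _ (fun x y => ?_) hc (fun x => ?_)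
    (commute_synthesis_mul_adjoint h hg hJ)
  · change inner ℂ (synthesis g hg (ContinuousLinearMap.adjoint (synthesis g hg) x)) y
      = inner ℂ x (synthesis g hg (ContinuousLinearMap.adjoint (synthesis g hg) y))
    rw [← ContinuousLinearMap.adjoint_inner_right,
      ← ContinuousLinearMap.adjoint_inner_left (synthesis g hg)]
  · change _ ≤ (inner ℂ (synthesis g hg (ContinuousLinearMap.adjoint (synthesis g hg) x)) x).re
    rw [← ContinuousLinearMap.adjoint_inner_right, inner_self_eq_norm_sq_to_K]
    refine (hlow x).trans_eq ?_
    simp [← Complex.ofReal_pow]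

theorem eq_closure_span_of_map_synthesis {f : I → H} (hf : IsBessel f) {A : Set I}
    {M : Submodule ℂ H} (hM : IsClosed (M : Set H))
    (hmap : (L2.supportedOn A).map (synthesis f hf : L2 I →ₗ[ℂ] H) = M) {s : Set H} (hs : s ⊆ M)
    (hA : ∀ i ∈ A, f i = 0 ∨ f i ∈ s) :
    M = (Submodule.span ℂ s).topologicalClosure := by
  refine le_antisymm ?_ (Submodule.topologicalClosure_minimal _ (Submodule.span_le.2 hs) hM)
  rw [← hmap]
  rintro _ ⟨c, hc, rfl⟩
  change synthesis f hf c ∈ _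
  rw [synthesis_apply]
  refine (Submodule.isClosed_topologicalClosure _).mem_of_tendsto (hf.summable c).hasSum
    (Eventually.of_forall fun s => Submodule.sum_mem _ fun i _ => ?_)
  refine Submodule.le_topologicalClosure _ ?_
  by_cases hi : i ∈ A
  · rcases hA i hi with h0 | h0
    · rw [h0, smul_zero]; exact Submodule.zero_mem _
    · exact Submodule.smul_mem _ _ (Submodule.subset_span h0)
  · rw [hc i hi, zero_smul]; exact Submodule.zero_mem _

theorem map_supportedOn_synthesis {f : I → H} (hf : IsBessel f) (V : (H →L[ℂ] H)ˣ)
    (hV : IsBessel fun i => V.1 (f i)) (A : Set I) {M N : Submodule ℂ H}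
    (hM : (L2.supportedOn A).map (synthesis f hf : L2 I →ₗ[ℂ] H) = M)
    (h1 : ∀ x ∈ M, V.1 x ∈ N) (h2 : ∀ x ∈ N, V⁻¹.1 x ∈ M) :
    (L2.supportedOn A).map (synthesis (fun i => V.1 (f i)) hV : L2 I →ₗ[ℂ] H) = N := by
  subst hM
  refine le_antisymm ?_ fun x hx => ?_
  · rintro _ ⟨c, hc, rfl⟩
    change synthesis _ hV c ∈ N
    rw [synthesis_map hf]
    exact h1 _ ⟨c, hc, rfl⟩
  · obtain ⟨c, hc, hcx⟩ := h2 x hx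
    refine ⟨c, hc, ?_⟩
    change synthesis _ hV c = x
    rw [synthesis_map hf, ← unit_apply_inv_apply V x, ← hcx]
    rfl

/-- The operator identity behind the Parseval property. -/
theorem parseval_identity (h : IsFundamentalSymmetry B J) (U C S : (H →L[ℂ] H)ˣ)
    {A : H →L[ℂ] H} (hC1 : star C.1 = C.1) (hC2 : C.1 * (star U.1 * J * U.1 * J) * C.1 = 1)
    (hC3 : Commute C.1 J) (hS1 : star S.1 = S.1) (hS2 : S.1 * A * S.1 = 1) :
    (U.1 * C.1 * S.1) * A * star (U.1 * C.1 * S.1) * star (U.1 * J * U⁻¹.1) * J = 1 := by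
  have hU : star U.1 * star U⁻¹.1 = 1 := by rw [← star_mul, Units.inv_mul, star_one]
  have e1 : (U.1 * C.1 * S.1) * A * star (U.1 * C.1 * S.1) * star (U.1 * J * U⁻¹.1) * J
      = U.1 * (C.1 * C.1 * J * star U.1 * J) := by
    simp only [star_mul, hC1, hS1, h.star_eq]
    calc _ = U.1 * C.1 * (S.1 * A * S.1) * C.1 * (star U.1 * star U⁻¹.1) * J * star U.1 * J := by
          noncomm_ring
      _ = _ := by rw [hS2, hU]; noncomm_ring
  have hCC : C.1 * C.1 * (star U.1 * J * U.1 * J) = 1 := by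
    have h2 : C.1 * (star U.1 * J * U.1 * J) = C⁻¹.1 := Units.eq_inv_of_mul_eq_one_right hC2
    rw [mul_assoc, h2, Units.mul_inv]
  -- A left inverse of `U`; as `U` is invertible it is also a right inverse, which is what remains
  -- after `e1`.
  have e2 : (C.1 * C.1 * J * star U.1 * J) * U.1 = 1 := by
    have hCJ : Commute (C.1 * C.1) J := hC3.mul_left hC3
    calc _ = C.1 * C.1 * J * (star U.1 * J * U.1 * (J * J)) := by
          rw [h.mul_self]; noncomm_ring
      _ = J * (C.1 * C.1 * (star U.1 * J * U.1 * J)) * J := by rw [hCJ.eq]; noncomm_ring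
      _ = 1 := by rw [hCC, mul_one, h.mul_self]
  rw [e1]
  rw [← mul_one (C.1 * C.1 * J * star U.1 * J), ← Units.mul_inv U, ← mul_assoc _ U.1, e2, one_mul,
    Units.mul_inv]

end FrameOperator

end Krein

end

/-! ### The similar Parseval `J`-frame -/

theorem mainTheorem12 {H : Type*} [NormedAddCommGroup H] [InnerProductSpace ℂ H] [CompleteSpace H]
    (B : H →ₗ⋆[ℂ] H →ₗ[ℂ] ℂ) (hB : Krein.IsKreinSpace B)
    {I : Type*} (f : I → H) (hf : Krein.IsJFrame B f)
    (Hp Hm : Submodule ℂ H) (hD : Krein.IsFundamentalDecomposition B Hp Hm) :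
    ∃ q : I → H, Krein.IsParsevalJFrame B q ∧ Krein.IsSimilar f q ∧
      Hp = (Submodule.span ℂ {x : H | ∃ i, q i = x ∧ 0 < (B (q i) (q i)).re}).topologicalClosure := by
  classical
  open Krein in
  obtain ⟨J, h⟩ := hB.exists_isFundamentalSymmetry
  obtain ⟨hbf, hMp, hMm⟩ := hf
  set Mp := (L2.supportedOn (indexPos B f)).map (synthesis f hbf : L2 I →ₗ[ℂ] H) with hMpdef
  set Mm := (L2.supportedOn (indexNeg B f)).map (synthesis f hbf : L2 I →ₗ[ℂ] H) with hMmdef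
  obtain ⟨W, hW1, hW2, hW3, hW4⟩ := h.exists_unit_map hMp hMm
  obtain ⟨U, hU1, hU2, hU3, hU4⟩ := h.exists_unit_map (hD.maximal_left h) (hD.maximal_right h)
  have hfp : ∀ i ∈ indexPos B f, f i ∈ Mp := fun i hi => mem_map_synthesis hbf hi
  have hfm : ∀ i ∈ indexNeg B f, f i ∈ Mm := fun i hi => mem_map_synthesis hbf hi
  have hsign : ∀ i, i ∈ indexPos B f ∨ i ∈ indexNeg B f := fun i => by
    rw [← indexPos_compl]; exact em _
  have hg : IsBessel fun i => W⁻¹.1 (f i) := hbf.map W⁻¹.1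
  have hsurj : Function.Surjective (synthesis _ hg) := fun x => by
    obtain ⟨a, -, ha⟩ := hW1 _ (h.posProj_mem x)
    obtain ⟨b, -, hb⟩ := hW2 _ (h.neg.posProj_mem x)
    refine ⟨a + b, ?_⟩
    have ha' : synthesis f hbf a = _ := ha
    have hb' : synthesis f hbf b = _ := hb
    rw [synthesis_map hbf, map_add, ha', hb', ← map_add, IsFundamentalSymmetry.add_posProj,
      unit_inv_apply_apply]
  obtain ⟨S, hS1, hS2, hS3⟩ := exists_inv_sqrt_frameOperator h hg
    (fun i => (hsign i).imp (fun hi => hW3 _ (hfp i hi)) fun hi => hW4 _ (hfm i hi)) hsurj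
  obtain ⟨C, hC1, hC2, hC3⟩ := hD.exists_inv_sqrt_pullback h U hU1 hU2
  have hS3' : Commute S⁻¹.1 J := hS3.units_inv_left
  have hC3' : Commute C⁻¹.1 J := hC3.units_inv_left
  -- `W⁻¹` straightens the frame, `S` normalises it, `C` corrects `U` to preserve the form, and `U`
  -- lands in the given decomposition. `S` and `C` preserve both eigenspaces of `J`.
  let V : (H →L[ℂ] H)ˣ := U * C * S * W⁻¹
  have hV : ∀ x, V.1 x = U.1 (C.1 (S.1 (W⁻¹.1 x))) := fun x => rfl
  have hV' : ∀ x, V⁻¹.1 x = W.1 (S⁻¹.1 (C⁻¹.1 (U⁻¹.1 x))) := fun x => by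
    simp [V, mul_inv_rev]
  have hVp : ∀ x ∈ Mp, V.1 x ∈ Hp := fun x hx =>
    hU1 _ (mem_fixed_of_commute hC3 (mem_fixed_of_commute hS3 (hW3 x hx)))
  have hVm : ∀ x ∈ Mm, V.1 x ∈ Hm := fun x hx =>
    hU2 _ (mem_fixed_of_commute hC3.neg_right (mem_fixed_of_commute hS3.neg_right (hW4 x hx)))
  have hVp' : ∀ x ∈ Hp, V⁻¹.1 x ∈ Mp := fun x hx => by
    rw [hV']
    exact hW1 _ (mem_fixed_of_commute hS3' (mem_fixed_of_commute hC3' (hU3 x hx)))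
  have hVm' : ∀ x ∈ Hm, V⁻¹.1 x ∈ Mm := fun x hx => by
    rw [hV']
    exact hW2 _ (mem_fixed_of_commute hS3'.neg_right
      (mem_fixed_of_commute hC3'.neg_right (hU4 x hx)))
  have hq : IsBessel fun i => V.1 (f i) := hbf.map V.1
  obtain ⟨hip, him⟩ := hD.index_eq (f := f) (q := fun i => V.1 (f i))
    (fun i hi => hVp _ (hfp i hi)) (fun i hi => hVm _ (hfm i hi))
    fun i hi => by rw [← unit_inv_apply_apply V (f i), hi, map_zero]
  have hmapp := map_supportedOn_synthesis hbf V hq (indexPos B f) hMpdef.symm hVp hVp'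
  have hmapm := map_supportedOn_synthesis hbf V hq (indexNeg B f) hMmdef.symm hVm hVm'
  -- `U J U⁻¹` is the symmetry of the decomposition `Hp`, `Hm`, so it acts on each `qᵢ` by its sign.
  refine ⟨fun i => V.1 (f i), ⟨⟨hq, ?_, ?_⟩, hq, _, isKreinAdjoint_synthesis h hq
    (U.1 * J * U⁻¹.1) (fun i hi => ?_) (fun i hi => ?_), ?_⟩,
    ⟨ContinuousLinearEquiv.unitsEquiv ℂ H V, fun i => rfl⟩, ?_⟩
  · rw [hip, hmapp]
    exact hD.maximal_left h
  · rw [him, hmapm]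
    exact hD.maximal_right h
  · rw [hip] at hi
    have := mem_fixed.1 (hU3 _ (hVp _ (hfp i hi)))
    rw [mul_apply_eq_comp, mul_apply_eq_comp, this, unit_apply_inv_apply]
  · rw [him] at hi
    have := mem_fixed_neg.1 (hU4 _ (hVm _ (hfm i hi)))
    rw [mul_apply_eq_comp, mul_apply_eq_comp, this, map_neg, unit_apply_inv_apply]
  · have e : synthesis _ hq = (U.1 * C.1 * S.1) ∘L synthesis _ hg := by
      refine ContinuousLinearMap.ext fun x => ?_
      change _ = (U.1 * C.1 * S.1) (synthesis _ hg x)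
      rw [synthesis_map hbf, synthesis_map hbf]
      rfl
    rw [e, ContinuousLinearMap.adjoint_comp]
    exact parseval_identity h U C S hC1 hC2 hC3 hS1 hS2
  · refine eq_closure_span_of_map_synthesis hq
      (IsUniformlyPositive.isClosed_of_maximal h (hD.maximal_left h)) hmapp ?_ fun i hi => ?_
    · rintro _ ⟨i, rfl, hi⟩
      exact hVp _ (hfp i (hip.subset hi.le))
    -- The span uses strictly positive vectors while `I₊` allows `[qᵢ, qᵢ] = 0`; in `Hp` the latter
    -- occurs only for `qᵢ = 0`.
    · refine or_iff_not_imp_left.2 fun h0 => ⟨i, rfl, ?_⟩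
      exact hD.hilbert_pos.pos _ (hVp _ (hfp i hi)) h0
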